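/- Let $f:\mathbb{R}^n\to\mathbb{R}$ be three times continuously differentiable, with gradient $G=\nabla f$ and Hessian $H=\nabla^2 f$. Let $x^*$ be a local (in particular, possibly global) minimizer of $f$, and suppose that there are $\rho>0$ and $\Lambda_2>0$ such that $v^{T}H(x)v\ge\Lambda_2\|v\|_2^2$ for all $v\in\mathbb{R}^n$ and all $x$ in the open ball $B_\rho(x^*)$. For $\alpha>0$ and $x_{\rm new}=x-\alpha G(x)$ define the long and the short KGD step-sizes $$\mathcal{K}_1(x_{\rm new};x,\alpha)=\frac{\alpha}{2+\frac{2(f(x_{\rm new})-f(x))}{\alpha\|G(x)\|_2^2}},\qquad \mathcal{K}_1^{\rm s}(x_{\rm new};x,\alpha)=\frac{2\left(\alpha\|G(x)\|_2^2+f(x_{\rm new})-f(x)\right)}{\|G(x_{\rm new})-G(x)\|_2^2}.$$ Let $\mathsf{K}_1$ be either $\mathcal{K}_1$ or $\mathcal{K}_1^{\rm s}$, and, given $x_0\in\mathbb{R}^n$ and $\alpha_0>0$, consider the iteration $$x_{k+1}=x_k-\alpha_kG(x_k),\qquad \alpha_{k+1}=\mathsf{K}_1(x_{k+1};x_k,\alpha_k),\qquad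 k\ge 0,$$ which is regarded as terminated, with all later iterates equal to $x_k$, as soon as $G(x_k)=0$. Then there is a number $r$ with $0<r<\rho$ such that the following holds for every $0<\delta<r$: whenever $x_0,x_1\in B_\delta(x^*)$ and the sublevel set $\{y\in\mathbb{R}^n: f(y)\le f(x_0)\}$ is compact, the sequence $\{x_k\}$ converges to $x^*$ at least R-linearly, that is, $x_k\to x^*$ and there are constants $C$ and $c\in(0,1)$, which may depend on the sequence, with $\|x_k-x^*\|_2\le C\,c^k$ for all $k\ge 0$. -/

import Mathlib

open Filter Topology

noncomputable section

/-- The Hessian of `f` at `x`, as a linear operator: the derivative of the gradient. -/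
def hessian {n : ℕ} (f : EuclideanSpace ℝ (Fin n) → ℝ) (x : EuclideanSpace ℝ (Fin n)) :
    EuclideanSpace ℝ (Fin n) →L[ℝ] EuclideanSpace ℝ (Fin n) :=
  fderiv ℝ (gradient f) x

/-- The long KGD step-size for `xnew` (where `xnew = x - α ∇f(x)`). -/
def longKGD {n : ℕ} (f : EuclideanSpace ℝ (Fin n) → ℝ)
    (xnew x : EuclideanSpace ℝ (Fin n)) (α : ℝ) : ℝ :=
  α / (2 + 2 * (f xnew - f x) / (α * ‖gradient f x‖ ^ 2))

/-- The short KGD step-size for `xnew` (where `xnew = x - α ∇f(x)`). -/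
def shortKGD {n : ℕ} (f : EuclideanSpace ℝ (Fin n) → ℝ)
    (xnew x : EuclideanSpace ℝ (Fin n)) (α : ℝ) : ℝ :=
  2 * (α * ‖gradient f x‖ ^ 2 + (f xnew - f x)) / ‖gradient f xnew - gradient f x‖ ^ 2

/-- The choice between the long and the short step-size. -/
inductive KGDKind
  | long
  | short

/-- The step-size operator of the chosen kind. -/
def kgdStep {n : ℕ} (f : EuclideanSpace ℝ (Fin n) → ℝ) :
    KGDKind → EuclideanSpace ℝ (Fin n) → EuclideanSpace ℝ (Fin n) → ℝ → ℝ
  | KGDKind.long => longKGD f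
  | KGDKind.short => shortKGD f

/-- `x` and `α` are the iterates and step-sizes of the KGD iteration of the given kind.
The step-size formulas are `0 / 0` once the gradient vanishes, so the update of the step-size
is only imposed while `∇f(x k) ≠ 0`. If `∇f(x k) = 0` the method has terminated: the first
equation then keeps the iterates constant, whatever the later step-sizes are. -/
structure IsKGDIteration {n : ℕ} (f : EuclideanSpace ℝ (Fin n) → ℝ) (kind : KGDKind)
    (x : ℕ → EuclideanSpace ℝ (Fin n)) (α : ℕ → ℝ) : Prop where
  init_pos : 0 < α 0
  iterate : ∀ k, x (k + 1) = x k - α k • gradient f (x k)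
  stepsize : ∀ k, gradient f (x k) ≠ 0 →
    α (k + 1) = kgdStep f kind (x (k + 1)) (x k) (α k)

/-- `x` converges to `a` at least R-linearly. -/
def ConvergesRLinearly {n : ℕ} (x : ℕ → EuclideanSpace ℝ (Fin n))
    (a : EuclideanSpace ℝ (Fin n)) : Prop :=
  Tendsto x atTop (𝓝 a) ∧
    ∃ C c : ℝ, 0 < c ∧ c < 1 ∧ ∀ k, ‖x k - a‖ ≤ C * c ^ k

end

/-!
Near the minimizer, Taylor's formula makes both KGD step-sizes agree up to a factor close to one
with a Barzilai–Borwein step-size for the Hessian `A` at the minimizer. In an eigenbasis of `A` a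
gradient step multiplies the `l`-th component of the error by `1 - t * lam l`, up to a relatively
small perturbation. The components with the smallest eigenvalue always contract. A component with
a larger eigenvalue may grow, by a bounded factor; but once it dominates the components with
smaller eigenvalues, the next step-size, being close to an average of inverse eigenvalues weighted
by the displacement, satisfies `t * lam l ≤ 3 / 2`, so this component contracts in the next step.
With weights which increase rapidly with the eigenvalue, all weighted components hence obey one
common geometric bound, by an induction over two consecutive iterates.
-/

open scoped InnerProductSpace NNReal

section Diagonal

variable {ι V : Type*} [Fintype ι] [NormedAddCommGroup V] [InnerProductSpace ℝ V]

theorem abs_repr_le_norm (b : OrthonormalBasis ι ℝ V) (v : V) (i : ι) : |b.repr v i| ≤ ‖v‖ := by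
  simpa only [b.repr.norm_map, Real.norm_eq_abs] using PiLp.norm_apply_le (b.repr v) i

theorem norm_le_sum_abs_repr (b : OrthonormalBasis ι ℝ V) (v : V) : ‖v‖ ≤ ∑ i, |b.repr v i| :=
  calc ‖v‖ = ‖∑ i, b.repr v i • b i‖ := by rw [b.sum_repr]
    _ ≤ ∑ i, ‖b.repr v i • b i‖ := norm_sum_le _ _
    _ = ∑ i, |b.repr v i| := by simp [norm_smul]

theorem norm_sq_eq_sum_repr_sq (b : OrthonormalBasis ι ℝ V) (v : V) :
    ‖v‖ ^ 2 = ∑ i, b.repr v i ^ 2 := by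
  simp only [← b.sum_sq_inner_right, b.repr_apply_apply]

theorem inner_eq_sum_repr_mul (b : OrthonormalBasis ι ℝ V) (v w : V) :
    ⟪v, w⟫_ℝ = ∑ i, b.repr v i * b.repr w i := by
  simp only [← b.sum_inner_mul_inner v w, b.repr_apply_apply, real_inner_comm]

/-- `A` is diagonal in the orthonormal basis `b`, with eigenvalues `lam` in `[μ, L]`. -/
structure DiagonalizedBy (A : V →L[ℝ] V) (b : OrthonormalBasis ι ℝ V) (lam : ι → ℝ)
    (μ L : ℝ) : Prop where
  repr_apply : ∀ v i, b.repr (A v) i = lam i * b.repr v i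
  le_eigenvalue : ∀ i, μ ≤ lam i
  eigenvalue_le : ∀ i, lam i ≤ L

/-- The squared length of the component of `v` along the basis vectors whose eigenvalue is
smaller than that of the `l`-th one: the part of `v` on which gradient steps contract more
slowly than on the `l`-th component. -/
noncomputable def slowEnergy (b : OrthonormalBasis ι ℝ V) (lam : ι → ℝ) (l : ι) (v : V) : ℝ :=
  ∑ i with lam i < lam l, b.repr v i ^ 2

theorem slowEnergy_smul (b : OrthonormalBasis ι ℝ V) (lam : ι → ℝ) (l : ι) (t : ℝ) (v : V) :
    slowEnergy b lam l (t • v) = t ^ 2 * slowEnergy b lam l v := by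
  simp [slowEnergy, mul_pow, Finset.mul_sum]

theorem slowEnergy_eq_sum_ite (b : OrthonormalBasis ι ℝ V) (lam : ι → ℝ) (l : ι) (v : V) :
    slowEnergy b lam l v = ∑ i, if lam i < lam l then b.repr v i ^ 2 else 0 := by
  rw [slowEnergy, Finset.sum_filter]

namespace DiagonalizedBy

variable {A : V →L[ℝ] V} {b : OrthonormalBasis ι ℝ V} {lam : ι → ℝ} {μ L : ℝ}

theorem inner_eq (hA : DiagonalizedBy A b lam μ L) (v : V) :
    ⟪v, A v⟫_ℝ = ∑ i, lam i * b.repr v i ^ 2 := by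
  rw [inner_eq_sum_repr_mul b]
  refine Finset.sum_congr rfl fun i _ => ?_
  rw [hA.repr_apply]
  ring

theorem norm_sq_eq (hA : DiagonalizedBy A b lam μ L) (v : V) :
    ‖A v‖ ^ 2 = ∑ i, lam i ^ 2 * b.repr v i ^ 2 := by
  simp only [norm_sq_eq_sum_repr_sq b, hA.repr_apply, mul_pow]

theorem mul_norm_sq_le_inner (hA : DiagonalizedBy A b lam μ L) (v : V) :
    μ * ‖v‖ ^ 2 ≤ ⟪v, A v⟫_ℝ := by
  rw [hA.inner_eq, norm_sq_eq_sum_repr_sq b, Finset.mul_sum]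
  gcongr with i
  exact hA.le_eigenvalue i

theorem inner_le_mul_norm_sq (hA : DiagonalizedBy A b lam μ L) (v : V) :
    ⟪v, A v⟫_ℝ ≤ L * ‖v‖ ^ 2 := by
  rw [hA.inner_eq, norm_sq_eq_sum_repr_sq b, Finset.mul_sum]
  gcongr with i
  exact hA.eigenvalue_le i

theorem mul_inner_le_norm_sq (hA : DiagonalizedBy A b lam μ L) (hμ : 0 ≤ μ) (v : V) :
    μ * ⟪v, A v⟫_ℝ ≤ ‖A v‖ ^ 2 := by
  rw [hA.inner_eq, hA.norm_sq_eq, Finset.mul_sum]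
  refine Finset.sum_le_sum fun i _ => ?_
  have hi := hA.le_eigenvalue i
  calc μ * (lam i * b.repr v i ^ 2) ≤ lam i * (lam i * b.repr v i ^ 2) := by
        have : 0 ≤ lam i := hμ.trans hi
        gcongr
    _ = lam i ^ 2 * b.repr v i ^ 2 := by ring

theorem norm_sq_le_mul_inner (hA : DiagonalizedBy A b lam μ L) (hμ : 0 ≤ μ) (v : V) :
    ‖A v‖ ^ 2 ≤ L * ⟪v, A v⟫_ℝ := by
  rw [hA.inner_eq, hA.norm_sq_eq, Finset.mul_sum]
  refine Finset.sum_le_sum fun i _ => ?_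
  calc lam i ^ 2 * b.repr v i ^ 2 = lam i * (lam i * b.repr v i ^ 2) := by ring
    _ ≤ L * (lam i * b.repr v i ^ 2) := by
        have : 0 ≤ lam i := hμ.trans (hA.le_eigenvalue i)
        gcongr
        exact hA.eigenvalue_le i

theorem eigenvalue_mul_norm_sq_sub_le (hA : DiagonalizedBy A b lam μ L) (hμ : 0 ≤ μ) (l : ι)
    (v : V) : lam l * (‖v‖ ^ 2 - slowEnergy b lam l v) ≤ ⟪v, A v⟫_ℝ := by
  rw [hA.inner_eq, norm_sq_eq_sum_repr_sq b, slowEnergy_eq_sum_ite, ← Finset.sum_sub_distrib,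
    Finset.mul_sum]
  refine Finset.sum_le_sum fun i _ => ?_
  have hi : 0 ≤ lam i := hμ.trans (hA.le_eigenvalue i)
  split_ifs with h
  · rw [sub_self, mul_zero]
    positivity
  · rw [sub_zero]
    gcongr
    exact not_lt.1 h

theorem eigenvalue_mul_inner_le (hA : DiagonalizedBy A b lam μ L) (hμ : 0 ≤ μ) (l : ι) (v : V) :
    lam l * ⟪v, A v⟫_ℝ ≤ ‖A v‖ ^ 2 + lam l ^ 2 * slowEnergy b lam l v := by
  rw [hA.inner_eq, hA.norm_sq_eq, slowEnergy_eq_sum_ite, Finset.mul_sum, Finset.mul_sum,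
    ← Finset.sum_add_distrib]
  refine Finset.sum_le_sum fun i _ => ?_
  have hi : 0 ≤ lam i := hμ.trans (hA.le_eigenvalue i)
  have hl : 0 ≤ lam l := hμ.trans (hA.le_eigenvalue l)
  split_ifs with h
  · have hil : lam l * lam i ≤ lam i ^ 2 + lam l ^ 2 := by nlinarith only [h, hi, hl]
    nlinarith only [mul_le_mul_of_nonneg_right hil (sq_nonneg (b.repr v i))]
  · have hli : lam l * lam i ≤ lam i ^ 2 := by nlinarith only [h, hi]
    nlinarith only [mul_le_mul_of_nonneg_right hli (sq_nonneg (b.repr v i))]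

theorem eigenvalue_sq_mul_repr_sq_le (hA : DiagonalizedBy A b lam μ L) (l : ι) (v : V) :
    lam l ^ 2 * b.repr v l ^ 2 ≤ ‖A v‖ ^ 2 := by
  rw [hA.norm_sq_eq]
  exact Finset.single_le_sum (f := fun i => lam i ^ 2 * b.repr v i ^ 2)
    (fun i _ => by positivity) (Finset.mem_univ l)

end DiagonalizedBy

theorem exists_diagonalizedBy_of_isSymmetric [FiniteDimensional ℝ V] {A : V →L[ℝ] V}
    (hA : A.toLinearMap.IsSymmetric) {μ : ℝ} (hμ : ∀ v, μ * ‖v‖ ^ 2 ≤ ⟪v, A v⟫_ℝ) :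
    ∃ (b : OrthonormalBasis (Fin (Module.finrank ℝ V)) ℝ V) (lam : Fin (Module.finrank ℝ V) → ℝ)
      (L : ℝ), μ ≤ L ∧ DiagonalizedBy A b lam μ L := by
  let b := hA.eigenvectorBasis rfl
  have inner_basis (i) : ⟪b i, A (b i)⟫_ℝ = hA.eigenvalues rfl i := by
    have hAb : A (b i) = hA.eigenvalues rfl i • b i := hA.apply_eigenvectorBasis rfl i
    rw [hAb, inner_smul_right, real_inner_self_eq_norm_sq, b.norm_eq_one, one_pow, mul_one]
  refine ⟨b, hA.eigenvalues rfl, max μ ‖A‖, le_max_left _ _, ?_, fun i => ?_, fun i => ?_⟩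
  · exact hA.eigenvectorBasis_apply_self_apply rfl
  · simpa [inner_basis] using hμ (b i)
  · calc hA.eigenvalues rfl i = ⟪b i, A (b i)⟫_ℝ := (inner_basis i).symm
      _ ≤ ‖b i‖ * ‖A (b i)‖ := real_inner_le_norm _ _
      _ ≤ ‖A‖ := by simpa using A.le_opNorm (b i)
      _ ≤ max μ ‖A‖ := le_max_right _ _

end Diagonal

section StepSizes

variable {ι V : Type*} [Fintype ι] [NormedAddCommGroup V] [InnerProductSpace ℝ V]
  {A : V →L[ℝ] V} {b : OrthonormalBasis ι ℝ V} {lam : ι → ℝ} {μ L t : ℝ} {s : V}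

/-- The step-size `t` chosen after the displacement `s` has (a version of) Dai's property (A):
it lies in `[a, β]`, and if the slower components of `s` are dominated by the `l`-th one then
the gradient step with step-size `t` contracts the `l`-th component. -/
def HasPropertyA (b : OrthonormalBasis ι ℝ V) (lam : ι → ℝ) (a β : ℝ) (s : V) (t : ℝ) : Prop :=
  t ∈ Set.Icc a β ∧ ∀ l, slowEnergy b lam l s ≤ b.repr s l ^ 2 / 16 → t * lam l ≤ 3 / 2

/-- `t` agrees, up to a factor in `[3/4, 5/4]`, with the long or the short Barzilai–Borwein
step-size for the operator `A` and the displacement `s`. -/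
def IsNearBarzilaiBorwein (A : V →L[ℝ] V) (s : V) (t : ℝ) : Prop :=
  ∃ κ ∈ Set.Icc (3 / 4 : ℝ) (5 / 4),
    t = κ * (‖s‖ ^ 2 / ⟪s, A s⟫_ℝ) ∨ t = κ * (⟪s, A s⟫_ℝ / ‖A s‖ ^ 2)

namespace DiagonalizedBy

theorem longBarzilaiBorwein_mem_Icc (hA : DiagonalizedBy A b lam μ L) (hμ : 0 < μ) (hμL : μ ≤ L)
    (hs : s ≠ 0) : ‖s‖ ^ 2 / ⟪s, A s⟫_ℝ ∈ Set.Icc (1 / L) (1 / μ) := by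
  have hL : 0 < L := hμ.trans_le hμL
  have lower := hA.mul_norm_sq_le_inner s
  have hinner : 0 < ⟪s, A s⟫_ℝ := lower.trans_lt' (by positivity)
  rw [Set.mem_Icc, div_le_div_iff₀ hL hinner, div_le_div_iff₀ hinner hμ]
  constructor <;> linarith [hA.inner_le_mul_norm_sq s]

theorem shortBarzilaiBorwein_mem_Icc (hA : DiagonalizedBy A b lam μ L) (hμ : 0 < μ) (hμL : μ ≤ L)
    (hs : s ≠ 0) : ⟪s, A s⟫_ℝ / ‖A s‖ ^ 2 ∈ Set.Icc (1 / L) (1 / μ) := by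
  have hL : 0 < L := hμ.trans_le hμL
  have hinner : 0 < ⟪s, A s⟫_ℝ := (hA.mul_norm_sq_le_inner s).trans_lt' (by positivity)
  have lower := hA.mul_inner_le_norm_sq hμ.le s
  have hAs : 0 < ‖A s‖ ^ 2 := lower.trans_lt' (by positivity)
  rw [Set.mem_Icc, div_le_div_iff₀ hL hAs, div_le_div_iff₀ hAs hμ]
  constructor <;> linarith [hA.norm_sq_le_mul_inner hμ.le s]

theorem longBarzilaiBorwein_mul_eigenvalue_le (hA : DiagonalizedBy A b lam μ L) (hμ : 0 < μ)
    (hs : s ≠ 0) {l : ι} (hl : slowEnergy b lam l s ≤ b.repr s l ^ 2 / 16) :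
    ‖s‖ ^ 2 / ⟪s, A s⟫_ℝ * lam l ≤ 6 / 5 := by
  have hinner : 0 < ⟪s, A s⟫_ℝ := (hA.mul_norm_sq_le_inner s).trans_lt' (by positivity)
  have hlam : 0 < lam l := hμ.trans_le (hA.le_eigenvalue l)
  have hsl : b.repr s l ^ 2 ≤ ‖s‖ ^ 2 := sq_le_sq' (abs_le.1 (abs_repr_le_norm b s l)).1
    (abs_le.1 (abs_repr_le_norm b s l)).2
  rw [div_mul_eq_mul_div, div_le_iff₀ hinner]
  have key : lam l * (15 / 16 * ‖s‖ ^ 2) ≤ ⟪s, A s⟫_ℝ :=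
    le_trans (by gcongr; linarith) (hA.eigenvalue_mul_norm_sq_sub_le hμ.le l s)
  linarith

theorem shortBarzilaiBorwein_mul_eigenvalue_le (hA : DiagonalizedBy A b lam μ L) (hμ : 0 < μ)
    (hs : s ≠ 0) {l : ι} (hl : slowEnergy b lam l s ≤ b.repr s l ^ 2 / 16) :
    ⟪s, A s⟫_ℝ / ‖A s‖ ^ 2 * lam l ≤ 6 / 5 := by
  have hinner : 0 < ⟪s, A s⟫_ℝ := (hA.mul_norm_sq_le_inner s).trans_lt' (by positivity)
  have hAs : 0 < ‖A s‖ ^ 2 := (hA.mul_inner_le_norm_sq hμ.le s).trans_lt' (by positivity)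
  rw [div_mul_eq_mul_div, div_le_iff₀ hAs]
  have slow : lam l ^ 2 * slowEnergy b lam l s ≤ ‖A s‖ ^ 2 / 16 := by
    calc lam l ^ 2 * slowEnergy b lam l s ≤ lam l ^ 2 * (b.repr s l ^ 2 / 16) := by gcongr
      _ ≤ ‖A s‖ ^ 2 / 16 := by linarith [hA.eigenvalue_sq_mul_repr_sq_le l s]
  linarith [hA.eigenvalue_mul_inner_le hμ.le l s]

theorem hasPropertyA_of_isNearBarzilaiBorwein (hA : DiagonalizedBy A b lam μ L) (hμ : 0 < μ)
    (hμL : μ ≤ L) (hs : s ≠ 0) (ht : IsNearBarzilaiBorwein A s t) :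
    HasPropertyA b lam (1 / (2 * L)) (2 / μ) s t := by
  obtain ⟨κ, hκ, ht⟩ := ht
  obtain ⟨τ, rfl, ⟨τ_ge, τ_le⟩, τ_mul_le⟩ : ∃ τ, t = κ * τ ∧ τ ∈ Set.Icc (1 / L) (1 / μ) ∧
      ∀ l, slowEnergy b lam l s ≤ b.repr s l ^ 2 / 16 → τ * lam l ≤ 6 / 5 := by
    rcases ht with rfl | rfl
    · exact ⟨_, rfl, hA.longBarzilaiBorwein_mem_Icc hμ hμL hs,
        fun _ => hA.longBarzilaiBorwein_mul_eigenvalue_le hμ hs⟩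
    · exact ⟨_, rfl, hA.shortBarzilaiBorwein_mem_Icc hμ hμL hs,
        fun _ => hA.shortBarzilaiBorwein_mul_eigenvalue_le hμ hs⟩
  have hL : 0 < L := hμ.trans_le hμL
  have hτ : 0 < τ := τ_ge.trans_lt' (by positivity)
  have hκ0 : 0 < κ := hκ.1.trans_lt' (by norm_num)
  refine ⟨⟨?_, ?_⟩, fun l hl => ?_⟩
  · calc 1 / (2 * L) = 1 / 2 * (1 / L) := by ring
      _ ≤ κ * τ := mul_le_mul (by linarith [hκ.1]) τ_ge (by positivity) hκ0.le
  · calc κ * τ ≤ 2 * (1 / μ) := mul_le_mul (by linarith [hκ.2]) τ_le hτ.le (by norm_num)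
      _ = 2 / μ := by ring
  · have hlam : 0 < lam l := hμ.trans_le (hA.le_eigenvalue l)
    calc κ * τ * lam l = κ * (τ * lam l) := by ring
      _ ≤ 5 / 4 * (6 / 5) := mul_le_mul hκ.2 (τ_mul_le l hl) (by positivity) (by norm_num)
      _ = 3 / 2 := by norm_num

end DiagonalizedBy

theorem isNearBarzilaiBorwein_long {q : ℝ} (hs : 0 < ⟪s, A s⟫_ℝ)
    (hq : |q - ⟪s, A s⟫_ℝ| ≤ ⟪s, A s⟫_ℝ / 16) : IsNearBarzilaiBorwein A s (‖s‖ ^ 2 / q) := by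
  obtain ⟨q_ge, q_le⟩ := abs_le.1 hq
  have hq0 : 0 < q := by linarith
  refine ⟨⟪s, A s⟫_ℝ / q, ⟨?_, ?_⟩, Or.inl ?_⟩
  · rw [le_div_iff₀ hq0]
    linarith
  · rw [div_le_iff₀ hq0]
    linarith
  · field_simp

theorem isNearBarzilaiBorwein_short {q z : ℝ} (hs : 0 < ⟪s, A s⟫_ℝ)
    (hq : |q - ⟪s, A s⟫_ℝ| ≤ ⟪s, A s⟫_ℝ / 16) (hz : |z - ‖A s‖| ≤ ‖A s‖ / 16) :
    IsNearBarzilaiBorwein A s (q / z ^ 2) := by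
  obtain ⟨q_ge, q_le⟩ := abs_le.1 hq
  obtain ⟨z_ge, z_le⟩ := abs_le.1 hz
  have hAs : 0 < ‖A s‖ := norm_pos_iff.2 fun h => by simp [h] at hs
  have hz0 : 0 < z := by linarith
  have z_sq_ge : (15 / 16 * ‖A s‖) ^ 2 ≤ z ^ 2 := by gcongr; linarith
  have z_sq_le : z ^ 2 ≤ (17 / 16 * ‖A s‖) ^ 2 := by gcongr; linarith
  have q_ratio_ge : 15 / 16 ≤ q / ⟪s, A s⟫_ℝ := by rw [le_div_iff₀ hs]; linarith
  have q_ratio_le : q / ⟪s, A s⟫_ℝ ≤ 17 / 16 := by rw [div_le_iff₀ hs]; linarith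
  have z_ratio_ge : (16 / 17) ^ 2 ≤ ‖A s‖ ^ 2 / z ^ 2 := by
    rw [le_div_iff₀ (by positivity)]; linarith
  have z_ratio_le : ‖A s‖ ^ 2 / z ^ 2 ≤ (16 / 15) ^ 2 := by
    rw [div_le_iff₀ (by positivity)]; linarith
  refine ⟨q / ⟪s, A s⟫_ℝ * (‖A s‖ ^ 2 / z ^ 2), ⟨?_, ?_⟩, Or.inr ?_⟩
  · calc (3 / 4 : ℝ) ≤ 15 / 16 * (16 / 17) ^ 2 := by norm_num
      _ ≤ q / ⟪s, A s⟫_ℝ * (‖A s‖ ^ 2 / z ^ 2) :=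
        mul_le_mul q_ratio_ge z_ratio_ge (by positivity) (q_ratio_ge.trans' (by norm_num))
  · calc q / ⟪s, A s⟫_ℝ * (‖A s‖ ^ 2 / z ^ 2) ≤ 17 / 16 * (16 / 15) ^ 2 :=
          mul_le_mul q_ratio_le z_ratio_le (by positivity) (by norm_num)
      _ ≤ 5 / 4 := by norm_num
  · field_simp

end StepSizes

section TwoSteps

theorem exists_separated_weight {ι : Type*} [Finite ι] (lam : ι → ℝ) {Q : ℝ} (hQ : 1 ≤ Q) :
    ∃ w : ι → ℝ, (∀ l, 1 ≤ w l) ∧ ∀ j l, lam j < lam l → Q * w j ≤ w l := by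
  refine ⟨fun l => Q ^ {i | lam i < lam l}.ncard, fun l => one_le_pow₀ hQ, fun j l hjl => ?_⟩
  have ncard_lt : {i | lam i < lam j}.ncard < {i | lam i < lam l}.ncard :=
    Set.ncard_lt_ncard ⟨fun i hi => lt_trans hi hjl, fun h => lt_irrefl (lam j) (h hjl)⟩
  rw [← pow_succ']
  exact pow_le_pow_right₀ hQ ncard_lt

variable {ι V : Type*} [Fintype ι] [NormedAddCommGroup V] [InnerProductSpace ℝ V]
  {A : V →L[ℝ] V} {b : OrthonormalBasis ι ℝ V} {lam : ι → ℝ} {μ L a β K t t' X D : ℝ}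
  {e e' g g' : V} {l : ι}

namespace DiagonalizedBy

theorem abs_repr_sub_smul_le (hA : DiagonalizedBy A b lam μ L) (ht : 0 ≤ t)
    (hg : ‖g - A e‖ ≤ D) (l : ι) :
    |b.repr (e - t • g) l| ≤ |1 - t * lam l| * |b.repr e l| + t * D := by
  have split_error : b.repr (e - t • g) l = (1 - t * lam l) * b.repr e l
      - t * b.repr (g - A e) l := by
    simp only [map_sub, map_smul, PiLp.sub_apply, PiLp.smul_apply, smul_eq_mul, hA.repr_apply]
    ring
  calc |b.repr (e - t • g) l|
      ≤ |(1 - t * lam l) * b.repr e l| + |t * b.repr (g - A e) l| := split_error ▸ abs_sub _ _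
    _ = |1 - t * lam l| * |b.repr e l| + t * |b.repr (g - A e) l| := by
        rw [abs_mul, abs_mul, abs_of_nonneg ht]
    _ ≤ |1 - t * lam l| * |b.repr e l| + t * D := by
        gcongr
        exact (abs_repr_le_norm b _ l).trans hg

theorem abs_repr_sub_smul_le_of_step_le (hA : DiagonalizedBy A b lam μ L) (hμ : 0 < μ)
    (hK : 1 + β * L ≤ K) (ht : t ∈ Set.Icc 0 β) (he : |b.repr e l| ≤ X)
    (hg : ‖g - A e‖ ≤ μ * D) : |b.repr (e - t • g) l| ≤ K * (X + D) := by
  have hlam := hA.le_eigenvalue l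
  have hlamL := hA.eigenvalue_le l
  have hD : 0 ≤ D := nonneg_of_mul_nonneg_right ((norm_nonneg _).trans hg) hμ
  have htlam : 0 ≤ t * lam l := mul_nonneg ht.1 (hμ.le.trans hlam)
  have hβL : t * lam l ≤ β * L :=
    mul_le_mul ht.2 hlamL (hμ.le.trans hlam) (ht.1.trans ht.2)
  have factor_le : |1 - t * lam l| ≤ K := abs_le.2 ⟨by linarith, by linarith⟩
  have htμ : t * μ ≤ K := by linarith [mul_le_mul_of_nonneg_left hlam ht.1]
  calc |b.repr (e - t • g) l|
      ≤ |1 - t * lam l| * |b.repr e l| + t * (μ * D) := hA.abs_repr_sub_smul_le ht.1 hg l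
    _ = |1 - t * lam l| * |b.repr e l| + t * μ * D := by ring
    _ ≤ K * X + K * D := by
        gcongr
        exact (abs_nonneg _).trans factor_le
    _ = K * (X + D) := by ring

theorem abs_repr_sub_smul_le_of_mul_eigenvalue_le (hA : DiagonalizedBy A b lam μ L) (hμ : 0 < μ)
    (ha : 0 < a) (haμ : a * μ ≤ 1 / 2) (hK : 1 + β * L ≤ K) (ht : t ∈ Set.Icc a β)
    (htl : t * lam l ≤ 3 / 2) (hg : ‖g - A e‖ ≤ μ * D) :
    |b.repr (e - t • g) l| ≤ (1 - a * μ) * |b.repr e l| + K * D := by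
  have hlam := hA.le_eigenvalue l
  have hD : 0 ≤ D := nonneg_of_mul_nonneg_right ((norm_nonneg _).trans hg) hμ
  have ht0 : 0 < t := ha.trans_le ht.1
  have htlam : a * μ ≤ t * lam l := mul_le_mul ht.1 hlam hμ.le ht0.le
  have factor_le : |1 - t * lam l| ≤ 1 - a * μ := abs_le.2 ⟨by linarith, by linarith⟩
  have htμ : t * μ ≤ K := by
    have : t * μ ≤ β * L :=
      mul_le_mul ht.2 (hlam.trans (hA.eigenvalue_le l)) hμ.le (ht0.le.trans ht.2)
    linarith
  calc |b.repr (e - t • g) l|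
      ≤ |1 - t * lam l| * |b.repr e l| + t * (μ * D) := hA.abs_repr_sub_smul_le ht0.le hg l
    _ = |1 - t * lam l| * |b.repr e l| + t * μ * D := by ring
    _ ≤ (1 - a * μ) * |b.repr e l| + K * D := by gcongr

theorem abs_repr_two_steps_le (hA : DiagonalizedBy A b lam μ L) (hμ : 0 < μ) (hK1 : 1 ≤ K)
    (hK : 1 + β * L ≤ K) (ht : t ∈ Set.Icc 0 β) (ht' : t' ∈ Set.Icc 0 β)
    (he : |b.repr e l| ≤ X) (hg : ‖g - A e‖ ≤ μ * X) (he' : e' = e - t • g)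
    (hg' : ‖g' - A e'‖ ≤ μ * X) : |b.repr (e' - t' • g') l| ≤ 3 * K ^ 2 * X := by
  have hX : 0 ≤ X := (abs_nonneg _).trans he
  have first_step : |b.repr e' l| ≤ K * (X + X) :=
    he' ▸ hA.abs_repr_sub_smul_le_of_step_le hμ hK ht he hg
  calc |b.repr (e' - t' • g') l|
      ≤ K * (K * (X + X) + X) := hA.abs_repr_sub_smul_le_of_step_le hμ hK ht' first_step hg'
    _ ≤ K * (K * (X + X) + K * X) := by
        gcongr
        exact le_mul_of_one_le_left hX hK1
    _ = 3 * K ^ 2 * X := by ring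

theorem abs_repr_perturbed_le (hA : DiagonalizedBy A b lam μ L) (hμ : 0 < μ)
    (hg : ‖g - A e‖ ≤ μ * X) {j : ι} (hj : lam j < lam l) (he : |b.repr e j| ≤ X) :
    |b.repr g j| ≤ 2 * (lam l * X) := by
  have hX : 0 ≤ X := (abs_nonneg _).trans he
  have hμj := hA.le_eigenvalue j
  have hj0 : 0 < lam j := hμ.trans_le hμj
  have error : |b.repr (g - A e) j| ≤ μ * X := (abs_repr_le_norm b _ j).trans hg
  calc |b.repr g j| = |lam j * b.repr e j + b.repr (g - A e) j| := by
        rw [← hA.repr_apply, map_sub, PiLp.sub_apply, add_sub_cancel]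
    _ ≤ |lam j * b.repr e j| + |b.repr (g - A e) j| := abs_add_le _ _
    _ = lam j * |b.repr e j| + |b.repr (g - A e) j| := by rw [abs_mul, abs_of_pos hj0]
    _ ≤ lam l * X + lam l * X := by
        have hμl : μ ≤ lam l := hμj.trans hj.le
        have hl0 : 0 ≤ lam l := hμ.le.trans hμl
        gcongr
        exact error.trans (by gcongr)
    _ = 2 * (lam l * X) := by ring

theorem le_abs_repr_perturbed (hA : DiagonalizedBy A b lam μ L) (hμ : 0 < μ) (hX : 0 ≤ X)
    (hg : ‖g - A e‖ ≤ μ * X) (l : ι) : lam l * (|b.repr e l| - X) ≤ |b.repr g l| := by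
  have hμl := hA.le_eigenvalue l
  have error : |b.repr (A e - g) l| ≤ lam l * X :=
    (abs_repr_le_norm b _ l).trans (norm_sub_rev g (A e) ▸ hg.trans (by gcongr))
  have triangle : |b.repr (A e) l| - |b.repr g l| ≤ |b.repr (A e - g) l| := by
    rw [map_sub, PiLp.sub_apply]
    exact abs_sub_abs_le_abs_sub _ _
  rw [hA.repr_apply, abs_mul, abs_of_pos (hμ.trans_le hμl)] at triangle
  linarith

theorem slowEnergy_le_of_dominant (hA : DiagonalizedBy A b lam μ L) (hμ : 0 < μ) (hX : 0 ≤ X)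
    (hg : ‖g - A e‖ ≤ μ * X) (hslow : ∀ j, lam j < lam l → |b.repr e j| ≤ X)
    (hdom : 9 * (Fintype.card ι + 1) * X ≤ |b.repr e l|) :
    slowEnergy b lam l g ≤ b.repr g l ^ 2 / 16 := by
  set N : ℝ := (Fintype.card ι : ℝ)
  have hN : 0 ≤ N := Nat.cast_nonneg _
  have hl : 0 < lam l := hμ.trans_le (hA.le_eigenvalue l)
  have component_ge : 8 * (N + 1) * (lam l * X) ≤ |b.repr g l| := by
    calc 8 * (N + 1) * (lam l * X) = lam l * (8 * (N + 1) * X) := by ring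
      _ ≤ lam l * (|b.repr e l| - X) := by
          gcongr
          linarith [mul_nonneg hN hX]
      _ ≤ |b.repr g l| := hA.le_abs_repr_perturbed hμ hX hg l
  calc slowEnergy b lam l g
      ≤ (Finset.univ.filter fun j => lam j < lam l).card • (2 * (lam l * X)) ^ 2 := by
        refine Finset.sum_le_card_nsmul _ _ _ fun j hj => ?_
        have hj := (Finset.mem_filter.1 hj).2
        exact sq_le_sq.2 ((hA.abs_repr_perturbed_le hμ hg hj (hslow j hj)).trans (le_abs_self _))
    _ ≤ N * (2 * (lam l * X)) ^ 2 := by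
        rw [nsmul_eq_mul]
        gcongr
        exact Nat.cast_le.2 (Finset.card_le_univ _)
    _ ≤ (8 * (N + 1) * (lam l * X)) ^ 2 / 16 := by
        nlinarith only [mul_nonneg hN (sq_nonneg (lam l * X)), sq_nonneg (lam l * X),
          sq_nonneg (N * (lam l * X))]
    _ ≤ b.repr g l ^ 2 / 16 := by
        rw [← sq_abs (b.repr g l)]
        gcongr

theorem mul_eigenvalue_le_of_dominant (hA : DiagonalizedBy A b lam μ L) (hμ : 0 < μ)
    (hX : 0 ≤ X) (hg : ‖g - A e‖ ≤ μ * X) (hslow : ∀ j, lam j < lam l → |b.repr e j| ≤ X)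
    (hdom : 9 * (Fintype.card ι + 1) * X ≤ |b.repr e l|)
    (ht' : HasPropertyA b lam a β (-(t • g)) t') : t' * lam l ≤ 3 / 2 := by
  refine ht'.2 l ?_
  have := hA.slowEnergy_le_of_dominant hμ hX hg hslow hdom
  rw [← neg_smul, slowEnergy_smul, map_smul, PiLp.smul_apply, smul_eq_mul, mul_pow, mul_div_assoc]
  gcongr

end DiagonalizedBy

/-- The constants of the contraction argument for step-sizes in `[a, β]`: a bound `K` for the
growth of a component in a single step, weights `w` and a noise level `σ` for which two
successive gradient steps contract every weighted component by the factor `(1 - a * μ / 2) ^ 2`.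
A component with a larger eigenvalue has a much larger weight, so that it is either negligible
or dominates all the slower components. The constant is `108 = 9 * 3 * 4`: a component below the
dominance threshold `9 * (card ι + 1) * X` grows in two steps by a factor of at most `3 * K ^ 2`,
and `(1 - a * μ / 2) ^ 2 ≥ 1 / 4`. -/
structure IsContractionData (lam : ι → ℝ) (μ L a β K σ : ℝ) (w : ι → ℝ) : Prop where
  step_pos : 0 < a
  step_mul_le_half : a * μ ≤ 1 / 2
  one_le_growth : 1 ≤ K
  le_growth : 1 + β * L ≤ K
  one_le_weight : ∀ l, 1 ≤ w l
  separated : ∀ j l, lam j < lam l → 108 * K ^ 2 * (Fintype.card ι + 1) * w j ≤ w l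
  noise_pos : 0 < σ
  noise_le_one : 108 * K ^ 2 * (Fintype.card ι + 1) * σ ≤ 1
  noise_le_rate : 2 * K * σ ≤ a * μ

theorem exists_isContractionData (lam : ι → ℝ) (hμ : 0 < μ) (hβL : 0 ≤ β * L) (ha : 0 < a)
    (haμ : a * μ ≤ 1 / 2) : ∃ K σ w, IsContractionData lam μ L a β K σ w := by
  have hK : 1 ≤ 1 + β * L := by linarith
  set K := 1 + β * L with hK_def
  set Q : ℝ := 108 * K ^ 2 * (Fintype.card ι + 1)
  have hQ : 1 ≤ Q := by
    have : 1 ≤ K ^ 2 := one_le_pow₀ hK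
    have : (0 : ℝ) ≤ Fintype.card ι := Nat.cast_nonneg _
    nlinarith
  have hQ0 : 0 < Q := by positivity
  have hK0 : 0 < 2 * K := by positivity
  obtain ⟨w, one_le, separated⟩ := exists_separated_weight lam hQ
  exact ⟨K, min (1 / Q) (a * μ / (2 * K)), w, ha, haμ, hK, hK_def.ge, one_le, separated,
    by positivity, (le_div_iff₀' hQ0).1 (min_le_left _ _),
    (le_div_iff₀' hK0).1 (min_le_right _ _)⟩

namespace IsContractionData

variable {σ W : ℝ} {w : ι → ℝ}

theorem noise_mul_le (hw : IsContractionData lam μ L a β K σ w) (hW : 0 ≤ W)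
    (hX : 108 * K ^ 2 * (Fintype.card ι + 1) * X = w l * W) : σ * W ≤ X := by
  have hK := hw.one_le_growth
  have hQ : 0 < 108 * K ^ 2 * ((Fintype.card ι : ℝ) + 1) := by positivity
  refine le_of_mul_le_mul_left ?_ hQ
  calc 108 * K ^ 2 * (Fintype.card ι + 1) * (σ * W)
      = 108 * K ^ 2 * (Fintype.card ι + 1) * σ * W := by ring
    _ ≤ 1 * W := mul_le_mul_of_nonneg_right hw.noise_le_one hW
    _ ≤ w l * W := mul_le_mul_of_nonneg_right (hw.one_le_weight l) hW
    _ = 108 * K ^ 2 * (Fintype.card ι + 1) * X := hX.symm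

theorem abs_repr_le_of_lt (hw : IsContractionData lam μ L a β K σ w) (hW : 0 ≤ W)
    (hX : 108 * K ^ 2 * (Fintype.card ι + 1) * X = w l * W) (he : ∀ j, |b.repr e j| ≤ w j * W)
    {j : ι} (hj : lam j < lam l) : |b.repr e j| ≤ X := by
  have hK := hw.one_le_growth
  have hQ : 0 < 108 * K ^ 2 * ((Fintype.card ι : ℝ) + 1) := by positivity
  refine (he j).trans (le_of_mul_le_mul_left ?_ hQ)
  rw [hX, ← mul_assoc]
  exact mul_le_mul_of_nonneg_right (hw.separated j l hj) hW

theorem abs_repr_step_le (hw : IsContractionData lam μ L a β K σ w)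
    (hA : DiagonalizedBy A b lam μ L) (hμ : 0 < μ) (ht : t ∈ Set.Icc a β)
    (htl : t * lam l ≤ 3 / 2) (hW : 0 ≤ W) (he : |b.repr e l| ≤ w l * W)
    (hg : ‖g - A e‖ ≤ μ * (σ * W)) :
    |b.repr (e - t • g) l| ≤ w l * ((1 - a * μ / 2) * W) := by
  have haμ0 : 0 < a * μ := mul_pos hw.step_pos hμ
  have hW_le : W ≤ w l * W := le_mul_of_one_le_left hW (hw.one_le_weight l)
  calc |b.repr (e - t • g) l|
      ≤ (1 - a * μ) * |b.repr e l| + K * (σ * W) :=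
        hA.abs_repr_sub_smul_le_of_mul_eigenvalue_le hμ hw.step_pos
          hw.step_mul_le_half hw.le_growth ht htl hg
    _ = (1 - a * μ) * |b.repr e l| + 2 * K * σ / 2 * W := by ring
    _ ≤ (1 - a * μ) * (w l * W) + a * μ / 2 * (w l * W) := by
        have noise_le : 2 * K * σ / 2 ≤ a * μ / 2 := by linarith [hw.noise_le_rate]
        have : 0 ≤ 1 - a * μ := by linarith [hw.step_mul_le_half]
        gcongr
    _ = w l * ((1 - a * μ / 2) * W) := by ring

theorem abs_repr_two_steps_le (hw : IsContractionData lam μ L a β K σ w)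
    (hA : DiagonalizedBy A b lam μ L) (hμ : 0 < μ) (hW : 0 ≤ W) (he : ∀ l, |b.repr e l| ≤ w l * W)
    (hg : ‖g - A e‖ ≤ μ * (σ * W)) (ht : t ∈ Set.Icc a β) (he' : e' = e - t • g)
    (hwe' : ∀ l, |b.repr e' l| ≤ w l * ((1 - a * μ / 2) * W))
    (hg' : ‖g' - A e'‖ ≤ μ * (σ * ((1 - a * μ / 2) * W)))
    (ht' : HasPropertyA b lam a β (e' - e) t') (l : ι) :
    |b.repr (e' - t' • g') l| ≤ w l * ((1 - a * μ / 2) * ((1 - a * μ / 2) * W)) := by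
  set θ := 1 - a * μ / 2 with hθ
  have hK := hw.one_le_growth
  have haμ : 0 < a * μ := mul_pos hw.step_pos hμ
  have hθ_le : θ ≤ 1 := by linarith
  have hθ_ge : 1 / 2 ≤ θ := by linarith [hw.step_mul_le_half]
  obtain ⟨X, hX⟩ : ∃ X, 108 * K ^ 2 * (Fintype.card ι + 1) * X = w l * W :=
    ⟨w l * W / (108 * K ^ 2 * (Fintype.card ι + 1)), mul_div_cancel₀ _ (by positivity)⟩
  have noise_le : σ * W ≤ X := hw.noise_mul_le hW hX
  have hX0 : 0 ≤ X := noise_le.trans' (mul_nonneg hw.noise_pos.le hW)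
  have hg_le : ‖g - A e‖ ≤ μ * X := hg.trans (by gcongr)
  -- A dominant component is contracted by property (A); any other one has room to grow twice.
  by_cases hdom : 9 * (Fintype.card ι + 1) * X ≤ |b.repr e l|
  · refine hw.abs_repr_step_le hA hμ ht'.1 ?_ (by positivity) (hwe' l) hg'
    rw [he', sub_sub_cancel_left] at ht'
    exact hA.mul_eigenvalue_le_of_dominant hμ hX0 hg_le
      (fun j => hw.abs_repr_le_of_lt hW hX he) hdom ht'
  · set Y := 9 * (Fintype.card ι + 1) * X
    have hXY : X ≤ Y := le_mul_of_one_le_left hX0 (by norm_cast; omega)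
    have hg'_le : ‖g' - A e'‖ ≤ μ * Y := by
      refine hg'.trans (mul_le_mul_of_nonneg_left ?_ hμ.le)
      calc σ * (θ * W) ≤ σ * (1 * W) := by gcongr; exact hw.noise_pos.le
        _ ≤ Y := by rw [one_mul]; exact noise_le.trans hXY
    have hIcc : Set.Icc a β ⊆ Set.Icc 0 β := Set.Icc_subset_Icc_left hw.step_pos.le
    calc |b.repr (e' - t' • g') l| ≤ 3 * K ^ 2 * Y :=
          hA.abs_repr_two_steps_le hμ hK hw.le_growth (hIcc ht) (hIcc ht'.1)
            (not_le.1 hdom).le (hg_le.trans (by gcongr)) he' hg'_le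
      _ = 1 / 2 * (1 / 2 * (w l * W)) := by rw [← hX]; ring
      _ ≤ θ * (θ * (w l * W)) := by
          have := hw.one_le_weight l
          gcongr
      _ = w l * (θ * (θ * W)) := by ring

end IsContractionData

end TwoSteps

section Descent

variable {ι V : Type*} [Fintype ι] [NormedAddCommGroup V] [InnerProductSpace ℝ V]

/-- The recursion `e (k + 1) = e k - α k • G (e k)`, where the field `G` differs from the linear
map `A` by a relative error of at most `ε` in the ball of radius `R`, and where the step-sizes
have property (A) as long as the iterates stay in that ball. Once `G (e k) = 0` the recursion has
terminated and nothing is assumed about the step-sizes. -/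
structure IsPropertyADescent (A : V →L[ℝ] V) (b : OrthonormalBasis ι ℝ V) (lam : ι → ℝ)
    (a β R ε : ℝ) (G : V → V) (e : ℕ → V) (α : ℕ → ℝ) : Prop where
  norm_sub_le : ∀ v, ‖v‖ < R → ‖G v - A v‖ ≤ ε * ‖v‖
  init_pos : 0 < α 0
  iterate : ∀ k, e (k + 1) = e k - α k • G (e k)
  stepsize : ∀ k, ‖e k‖ < R → ‖e (k + 1)‖ < R → 0 < α k → G (e k) ≠ 0 →
    HasPropertyA b lam a β (e (k + 1) - e k) (α (k + 1))

/-- The induction hypothesis of the convergence proof: the weighted components of `e k` and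
`e (k + 1)` obey the geometric bound with rate `θ`, and unless the recursion has terminated the
current step-size lies in `[a, β]`. -/
structure HasDecayAt (b : OrthonormalBasis ι ℝ V) (a β θ M : ℝ) (w : ι → ℝ) (G : V → V)
    (e : ℕ → V) (α : ℕ → ℝ) (k : ℕ) : Prop where
  current : ∀ l, |b.repr (e k) l| ≤ w l * (θ ^ k * M)
  next : ∀ l, |b.repr (e (k + 1)) l| ≤ w l * (θ ^ (k + 1) * M)
  stepsize : G (e k) ≠ 0 → α k ∈ Set.Icc a β

variable {A : V →L[ℝ] V} {b : OrthonormalBasis ι ℝ V} {lam w : ι → ℝ}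
  {μ L a β R K σ E M X : ℝ} {G : V → V} {e : ℕ → V} {α : ℕ → ℝ} {k : ℕ}

theorem norm_le_of_abs_repr_le_weight {v : V} (hX : 0 ≤ X)
    (hv : ∀ l, |b.repr v l| ≤ w l * X) : ‖v‖ ≤ (1 + ∑ l, w l) * X :=
  calc ‖v‖ ≤ ∑ l, |b.repr v l| := norm_le_sum_abs_repr b v
    _ ≤ ∑ l, w l * X := Finset.sum_le_sum fun l _ => hv l
    _ = (∑ l, w l) * X := by rw [Finset.sum_mul]
    _ ≤ (1 + ∑ l, w l) * X := by gcongr; linarith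

theorem DiagonalizedBy.eq_zero_of_norm_apply_le (hA : DiagonalizedBy A b lam μ L) {ε : ℝ}
    (hεμ : ε < μ) {v : V} (hv : ‖A v‖ ≤ ε * ‖v‖) : v = 0 := by
  by_contra hv0
  have upper : μ * ‖v‖ ^ 2 ≤ ε * ‖v‖ ^ 2 :=
    calc μ * ‖v‖ ^ 2 ≤ ⟪v, A v⟫_ℝ := hA.mul_norm_sq_le_inner v
      _ ≤ ‖v‖ * ‖A v‖ := real_inner_le_norm v (A v)
      _ ≤ ‖v‖ * (ε * ‖v‖) := by gcongr
      _ = ε * ‖v‖ ^ 2 := by ring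
  exact hεμ.not_ge (le_of_mul_le_mul_right upper (by positivity))

namespace IsContractionData

theorem sum_weight_nonneg (hw : IsContractionData lam μ L a β K σ w) : 0 ≤ ∑ l, w l :=
  Finset.sum_nonneg fun l _ => zero_le_one.trans (hw.one_le_weight l)

theorem rate_mem_Ico (hw : IsContractionData lam μ L a β K σ w) (hμ : 0 < μ) :
    1 - a * μ / 2 ∈ Set.Ico (1 / 2 : ℝ) 1 := by
  have : 0 < a * μ := mul_pos hw.step_pos hμ
  constructor <;> linarith [hw.step_mul_le_half]

theorem noise_lt_one (hw : IsContractionData lam μ L a β K σ w) : σ < 1 := by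
  have hK : 1 ≤ K ^ 2 := one_le_pow₀ hw.one_le_growth
  have hcard : (1 : ℝ) ≤ Fintype.card ι + 1 := by linarith [(Fintype.card ι).cast_nonneg (α := ℝ)]
  have : 108 * 1 * 1 * σ ≤ 1 := hw.noise_le_one.trans' (by have := hw.noise_pos; gcongr)
  linarith

theorem noise_div_lt (hw : IsContractionData lam μ L a β K σ w) (hμ : 0 < μ) :
    μ * σ / (1 + ∑ l, w l) < μ := by
  have hS : 1 ≤ 1 + ∑ l, w l := by linarith [hw.sum_weight_nonneg]
  rw [div_lt_iff₀ (by positivity)]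
  exact mul_lt_mul_of_pos_left (hw.noise_lt_one.trans_le hS) hμ

theorem norm_lt (hw : IsContractionData lam μ L a β K σ w)
    (hμ : 0 < μ) (hM : 0 ≤ M) (hMR : (1 + ∑ l, w l) * M < R) {v : V}
    (hv : ∀ l, |b.repr v l| ≤ w l * ((1 - a * μ / 2) ^ k * M)) : ‖v‖ < R := by
  obtain ⟨hθ_ge, hθ_lt⟩ := hw.rate_mem_Ico hμ
  have hθ : 0 ≤ 1 - a * μ / 2 := by linarith
  have hS := hw.sum_weight_nonneg
  calc ‖v‖ ≤ (1 + ∑ l, w l) * ((1 - a * μ / 2) ^ k * M) :=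
        norm_le_of_abs_repr_le_weight (by positivity) hv
    _ ≤ (1 + ∑ l, w l) * M := by
        gcongr
        exact mul_le_of_le_one_left hM (pow_le_one₀ hθ hθ_lt.le)
    _ < R := hMR

end IsContractionData

namespace IsPropertyADescent

theorem mono {ε ε' : ℝ} (h : IsPropertyADescent A b lam a β R ε G e α) (hε : ε ≤ ε') :
    IsPropertyADescent A b lam a β R ε' G e α :=
  ⟨fun v hv => (h.norm_sub_le v hv).trans (by gcongr), h.init_pos, h.iterate, h.stepsize⟩

theorem terminates_of_field_eq_zero {ε : ℝ} (h : IsPropertyADescent A b lam a β R ε G e α)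
    (hA : DiagonalizedBy A b lam μ L) (hεμ : ε < μ) (hk : ‖e k‖ < R) (hG : G (e k) = 0) :
    G (e (k + 1)) = 0 ∧ e (k + 2) = 0 := by
  have current : e k = 0 := by
    refine hA.eq_zero_of_norm_apply_le hεμ ?_
    simpa [hG] using h.norm_sub_le (e k) hk
  have next : e (k + 1) = 0 := by rw [h.iterate, hG, smul_zero, sub_zero, current]
  have hG' : G (e (k + 1)) = 0 := by rw [next]; rwa [current] at hG
  exact ⟨hG', by rw [h.iterate, hG', smul_zero, sub_zero, next]⟩

theorem norm_field_sub_le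
    (h : IsPropertyADescent A b lam a β R (μ * σ / (1 + ∑ l, w l)) G e α)
    (hw : IsContractionData lam μ L a β K σ w) (hμ : 0 < μ) (hX : 0 ≤ X) (hk : ‖e k‖ < R)
    (hv : ∀ l, |b.repr (e k) l| ≤ w l * X) : ‖G (e k) - A (e k)‖ ≤ μ * (σ * X) := by
  have hS : 0 < 1 + ∑ l, w l := by linarith [hw.sum_weight_nonneg]
  have hσ := hw.noise_pos
  calc ‖G (e k) - A (e k)‖ ≤ μ * σ / (1 + ∑ l, w l) * ‖e k‖ := h.norm_sub_le _ hk
    _ ≤ μ * σ / (1 + ∑ l, w l) * ((1 + ∑ l, w l) * X) := by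
        gcongr
        exact norm_le_of_abs_repr_le_weight hX hv
    _ = μ * (σ * X) := by field_simp

theorem hasDecayAt_succ
    (h : IsPropertyADescent A b lam a β R (μ * σ / (1 + ∑ l, w l)) G e α)
    (hw : IsContractionData lam μ L a β K σ w)
    (hA : DiagonalizedBy A b lam μ L) (hμ : 0 < μ) (hM : 0 ≤ M)
    (hMR : (1 + ∑ l, w l) * M < R) (hk : HasDecayAt b a β (1 - a * μ / 2) M w G e α k) :
    HasDecayAt b a β (1 - a * μ / 2) M w G e α (k + 1) := by
  have hθ := hw.rate_mem_Ico hμ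
  have hek : ‖e k‖ < R := hw.norm_lt hμ hM hMR hk.current
  have hek' : ‖e (k + 1)‖ < R := hw.norm_lt hμ hM hMR hk.next
  by_cases hG : G (e k) = 0
  · obtain ⟨hG', hz⟩ := h.terminates_of_field_eq_zero hA (hw.noise_div_lt hμ) hek hG
    refine ⟨hk.next, fun l => ?_, fun hG'' => absurd hG' hG''⟩
    have := hw.one_le_weight l
    have := hθ.1
    rw [hz]
    simp only [map_zero, PiLp.zero_apply, abs_zero]
    positivity
  · have hα := hk.stepsize hG
    have hα' := h.stepsize k hek hek' (hw.step_pos.trans_le hα.1) hG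
    refine ⟨hk.next, fun l => ?_, fun _ => hα'.1⟩
    have hθM : 0 ≤ (1 - a * μ / 2) ^ k * M := by have := hθ.1; positivity
    have hθM' : 0 ≤ (1 - a * μ / 2) ^ (k + 1) * M := by have := hθ.1; positivity
    have next_error := h.norm_field_sub_le hw hμ hθM' hek' hk.next
    have next_bound := hk.next
    simp only [pow_succ', mul_assoc] at next_bound next_error ⊢
    rw [h.iterate]
    exact hw.abs_repr_two_steps_le hA hμ hθM hk.current
      (h.norm_field_sub_le hw hμ hθM hek hk.current) hα (h.iterate k) next_bound next_error hα' l

theorem abs_repr_two_le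
    (h : IsPropertyADescent A b lam a β R (μ * σ / (1 + ∑ l, w l)) G e α)
    (hw : IsContractionData lam μ L a β K σ w)
    (hA : DiagonalizedBy A b lam μ L) (hμ : 0 < μ) (hER : E < R)
    (he0 : ‖e 0‖ ≤ E) (he1 : ‖e 1‖ ≤ E) (l : ι) : |b.repr (e 2) l| ≤ 2 * (K * E) := by
  have hE : 0 ≤ E := (norm_nonneg _).trans he0
  have hK := hw.one_le_growth
  have he1_lt := he1.trans_lt hER
  by_cases hG : G (e 0) = 0
  · have hz := (h.terminates_of_field_eq_zero hA (hw.noise_div_lt hμ) (he0.trans_lt hER) hG).2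
    rw [hz]
    simp only [map_zero, PiLp.zero_apply, abs_zero]
    positivity
  · have hα := (h.stepsize 0 (he0.trans_lt hER) he1_lt h.init_pos hG).1
    have error : ‖G (e 1) - A (e 1)‖ ≤ μ * E :=
      (h.norm_sub_le (e 1) he1_lt).trans (by gcongr; exact (hw.noise_div_lt hμ).le)
    calc |b.repr (e 2) l| = |b.repr (e 1 - α 1 • G (e 1)) l| := by rw [h.iterate 1]
      _ ≤ K * (E + E) := hA.abs_repr_sub_smul_le_of_step_le hμ hw.le_growth
          ⟨hw.step_pos.le.trans hα.1, hα.2⟩ ((abs_repr_le_norm b _ l).trans he1) error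
      _ = 2 * (K * E) := by ring

theorem hasDecayAt_one
    (h : IsPropertyADescent A b lam a β R (μ * σ / (1 + ∑ l, w l)) G e α)
    (hw : IsContractionData lam μ L a β K σ w)
    (hA : DiagonalizedBy A b lam μ L) (hμ : 0 < μ) (hER : E < R)
    (he0 : ‖e 0‖ ≤ E) (he1 : ‖e 1‖ ≤ E) :
    HasDecayAt b a β (1 - a * μ / 2) (8 * K * E) w G e α 1 := by
  have hE : 0 ≤ E := (norm_nonneg _).trans he0
  have hK := hw.one_le_growth
  have hθ := (hw.rate_mem_Ico hμ).1
  refine ⟨fun l => ?_, fun l => ?_, fun hG1 => ?_⟩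
  · calc |b.repr (e 1) l| ≤ ‖e 1‖ := abs_repr_le_norm b _ l
      _ ≤ 1 * ((1 / 2) ^ 1 * (8 * 1 * E)) := by linarith
      _ ≤ w l * ((1 - a * μ / 2) ^ 1 * (8 * K * E)) := by
          have := hw.one_le_weight l
          gcongr
  · calc |b.repr (e 2) l| ≤ 2 * (K * E) := h.abs_repr_two_le hw hA hμ hER he0 he1 l
      _ = 1 * ((1 / 2) ^ 2 * (8 * K * E)) := by ring
      _ ≤ w l * ((1 - a * μ / 2) ^ 2 * (8 * K * E)) := by
          have := hw.one_le_weight l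
          gcongr
  · have hG0 : G (e 0) ≠ 0 := fun hG =>
      hG1 (h.terminates_of_field_eq_zero hA (hw.noise_div_lt hμ) (he0.trans_lt hER) hG).1
    exact (h.stepsize 0 (he0.trans_lt hER) (he1.trans_lt hER) h.init_pos hG0).1

theorem norm_le
    (h : IsPropertyADescent A b lam a β R (μ * σ / (1 + ∑ l, w l)) G e α)
    (hw : IsContractionData lam μ L a β K σ w)
    (hA : DiagonalizedBy A b lam μ L) (hμ : 0 < μ)
    (hER : 8 * K * (1 + ∑ l, w l) * E < R) (he0 : ‖e 0‖ ≤ E) (he1 : ‖e 1‖ ≤ E) (k : ℕ) :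
    ‖e k‖ ≤ 8 * K * (1 + ∑ l, w l) * E * (1 - a * μ / 2) ^ k := by
  have hE : 0 ≤ E := (norm_nonneg _).trans he0
  have hK := hw.one_le_growth
  have hS := hw.sum_weight_nonneg
  have hθ : 0 ≤ 1 - a * μ / 2 := (hw.rate_mem_Ico hμ).1.trans' (by norm_num)
  have hE_le : E ≤ 8 * K * (1 + ∑ l, w l) * E :=
    le_mul_of_one_le_left hE (one_le_mul_of_one_le_of_one_le (by linarith) (by linarith))
  rcases k.eq_zero_or_pos with rfl | hk
  · simpa using he0.trans hE_le
  have decay : HasDecayAt b a β (1 - a * μ / 2) (8 * K * E) w G e α k :=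
    Nat.le_induction (h.hasDecayAt_one hw hA hμ (hE_le.trans_lt hER) he0 he1)
      (fun _ _ => h.hasDecayAt_succ hw hA hμ (by positivity) (hER.trans_eq' (by ring))) k hk
  calc ‖e k‖ ≤ (1 + ∑ l, w l) * ((1 - a * μ / 2) ^ k * (8 * K * E)) :=
        norm_le_of_abs_repr_le_weight (by positivity) decay.current
    _ = 8 * K * (1 + ∑ l, w l) * E * (1 - a * μ / 2) ^ k := by ring

end IsPropertyADescent

theorem DiagonalizedBy.exists_linear_rate (hA : DiagonalizedBy A b lam μ L) (hμ : 0 < μ)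
    (hβL : 0 ≤ β * L) (ha : 0 < a) (haμ : a * μ ≤ 1 / 2) :
    ∃ θ C ε : ℝ, 0 < θ ∧ θ < 1 ∧ 0 < C ∧ 0 < ε ∧ ∀ R E G e α,
      IsPropertyADescent A b lam a β R ε G e α → C * E < R → ‖e 0‖ ≤ E → ‖e 1‖ ≤ E →
        ∀ k, ‖e k‖ ≤ C * E * θ ^ k := by
  obtain ⟨K, σ, w, hw⟩ := exists_isContractionData lam hμ hβL ha haμ
  have hS : 0 < 1 + ∑ l, w l := by linarith [hw.sum_weight_nonneg]
  have hK : 0 < K := zero_lt_one.trans_le hw.one_le_growth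
  have hσ := hw.noise_pos
  have hθ := hw.rate_mem_Ico hμ
  exact ⟨1 - a * μ / 2, 8 * K * (1 + ∑ l, w l), μ * σ / (1 + ∑ l, w l), by linarith [hθ.1], hθ.2,
    by positivity, by positivity, fun R E G e α h hER he0 he1 => h.norm_le hw hA hμ hER he0 he1⟩

end Descent

section Calculus

variable {F : Type*} [NormedAddCommGroup F] [InnerProductSpace ℝ F] [CompleteSpace F]
  {f : F → ℝ} {A : F →L[ℝ] F} {s : Set F} {c : ℝ≥0} {x y : F}

theorem contDiffAt_gradient (hf : ContDiffAt ℝ 2 f x) : ContDiffAt ℝ 1 (gradient f) x :=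
  (InnerProductSpace.toDual ℝ F).symm.contDiff.contDiffAt.comp x
    (hf.fderiv_right (m := 1) (by norm_num))

theorem inner_fderiv_gradient_apply (hf : ContDiffAt ℝ 2 f x) (v w : F) :
    ⟪fderiv ℝ (gradient f) x v, w⟫_ℝ = fderiv ℝ (fderiv ℝ f) x v w := by
  have hgrad : HasFDerivAt (gradient f) (fderiv ℝ (gradient f) x) x :=
    ((contDiffAt_gradient hf).differentiableAt one_ne_zero).hasFDerivAt
  have hdual := (innerSL ℝ (E := F)).hasFDerivAt.comp x hgrad
  have : innerSL ℝ ∘ gradient f = fderiv ℝ f := toDual_comp_gradient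
  rw [this] at hdual
  rw [hdual.fderiv]
  rfl

theorem isSymmetric_fderiv_gradient (hf : ContDiffAt ℝ 2 f x) :
    (fderiv ℝ (gradient f) x).toLinearMap.IsSymmetric := by
  intro v w
  change ⟪fderiv ℝ (gradient f) x v, w⟫_ℝ = ⟪v, fderiv ℝ (gradient f) x w⟫_ℝ
  rw [real_inner_comm (fderiv ℝ (gradient f) x w) v, inner_fderiv_gradient_apply hf,
    inner_fderiv_gradient_apply hf]
  exact hf.isSymmSndFDerivAt (by simp) v w

theorem exists_ball_approximatesLinearOn_gradient (hf : ContDiffAt ℝ 2 f x) (hc : 0 < c) :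
    ∃ R > 0, (∀ z ∈ Metric.ball x R, DifferentiableAt ℝ f z) ∧
      ApproximatesLinearOn (gradient f) (fderiv ℝ (gradient f) x) (Metric.ball x R) c := by
  obtain ⟨s, hs, approx⟩ := ((contDiffAt_gradient hf).hasStrictFDerivAt
    one_ne_zero).approximates_deriv_on_nhds (Or.inr hc)
  have hdiff : ∀ᶠ z in 𝓝 x, DifferentiableAt ℝ f z :=
    (hf.eventually (by simp)).mono fun z hz => hz.differentiableAt two_ne_zero
  obtain ⟨R, hR, hball⟩ := Metric.mem_nhds_iff.1 (inter_mem hdiff hs)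
  exact ⟨R, hR, fun z hz => (hball hz).1, approx.mono_set fun z hz => (hball hz).2⟩

theorem hasDerivAt_taylor_remainder_segment {v : F} {t : ℝ}
    (hf : DifferentiableAt ℝ f (x + t • v)) :
    HasDerivAt (fun t : ℝ => f (x + t • v) - f x - t * ⟪gradient f x, v⟫_ℝ
      - t ^ 2 / 2 * ⟪v, A v⟫_ℝ) ⟪gradient f (x + t • v) - gradient f x - A (t • v), v⟫_ℝ t := by
  have line : HasDerivAt (fun t : ℝ => x + t • v) v t := by
    simpa using ((hasDerivAt_id t).smul_const v).const_add x
  have value : HasDerivAt (fun t : ℝ => f (x + t • v)) ⟪gradient f (x + t • v), v⟫_ℝ t := by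
    rw [inner_gradient_left]
    exact hf.hasFDerivAt.comp_hasDerivAt t line
  have linear := (hasDerivAt_id t).mul_const ⟪gradient f x, v⟫_ℝ
  have quadratic := ((hasDerivAt_pow 2 t).div_const 2).mul_const ⟪v, A v⟫_ℝ
  refine (((value.sub_const (f x)).sub linear).sub quadratic).congr_deriv ?_
  rw [inner_sub_left, inner_sub_left, map_smul, real_inner_smul_left, real_inner_comm v (A v)]
  norm_num

theorem abs_taylor_remainder_le (hs : Convex ℝ s) (hf : ∀ z ∈ s, DifferentiableAt ℝ f z)
    (hA : ApproximatesLinearOn (gradient f) A s c) (hx : x ∈ s) (hy : y ∈ s) :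
    |f y - f x - ⟪gradient f x, y - x⟫_ℝ - ⟪y - x, A (y - x)⟫_ℝ / 2| ≤ c / 2 * ‖y - x‖ ^ 2 := by
  set v := y - x with hv
  have segment_mem {t : ℝ} (ht : t ∈ Set.Icc (0 : ℝ) 1) : x + t • v ∈ s :=
    hs.add_smul_sub_mem hx hy ht
  have deriv_le {t : ℝ} (ht : t ∈ Set.Icc (0 : ℝ) 1) :
      ‖⟪gradient f (x + t • v) - gradient f x - A (t • v), v⟫_ℝ‖ ≤ c * ‖v‖ ^ 2 * t := by
    have approx := hA _ (segment_mem ht) _ hx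
    rw [add_sub_cancel_left, norm_smul, Real.norm_of_nonneg ht.1] at approx
    calc _ ≤ ‖gradient f (x + t • v) - gradient f x - A (t • v)‖ * ‖v‖ := norm_inner_le_norm _ _
      _ ≤ c * (t * ‖v‖) * ‖v‖ := by gcongr
      _ = c * ‖v‖ ^ 2 * t := by ring
  have majorant (t : ℝ) :
      HasDerivAt (fun t : ℝ => c * ‖v‖ ^ 2 * (t ^ 2 / 2)) (c * ‖v‖ ^ 2 * t) t := by
    simpa using ((hasDerivAt_pow 2 t).div_const 2).const_mul (c * ‖v‖ ^ 2)
  have remainder {t : ℝ} (ht : t ∈ Set.Icc (0 : ℝ) 1) :=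
    hasDerivAt_taylor_remainder_segment (A := A) (hf _ (segment_mem ht))
  have bound := image_norm_le_of_norm_deriv_right_le_deriv_boundary
    (fun t ht => (remainder ht).continuousAt.continuousWithinAt)
    (fun t ht => (remainder (Set.Ico_subset_Icc_self ht)).hasDerivWithinAt) (by simp) majorant
    (fun t ht => deriv_le (Set.Ico_subset_Icc_self ht)) (Set.right_mem_Icc.2 zero_le_one)
  simp only [one_smul, one_mul, one_pow, hv, add_sub_cancel, Real.norm_eq_abs] at bound
  convert bound using 1
  · congr 1; ring
  · ring

end Calculus

section KGD

variable {n : ℕ} {f : EuclideanSpace ℝ (Fin n) → ℝ} {x y xstar : EuclideanSpace ℝ (Fin n)}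
  {A : EuclideanSpace ℝ (Fin n) →L[ℝ] EuclideanSpace ℝ (Fin n)}
  {s : Set (EuclideanSpace ℝ (Fin n))} {c : ℝ≥0} {α μ : ℝ}

theorem longKGD_eq_norm_sq_div (hα : 0 < α) (hG : gradient f x ≠ 0)
    (hy : y = x - α • gradient f x) :
    longKGD f y x α = ‖y - x‖ ^ 2 / (2 * (α * ‖gradient f x‖ ^ 2 + (f y - f x))) := by
  have displacement : ‖y - x‖ ^ 2 = α * (α * ‖gradient f x‖ ^ 2) := by
    rw [hy, sub_sub_cancel_left, norm_neg, norm_smul, Real.norm_of_nonneg hα.le]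
    ring
  have denominator : 2 + 2 * (f y - f x) / (α * ‖gradient f x‖ ^ 2) =
      2 * (α * ‖gradient f x‖ ^ 2 + (f y - f x)) / (α * ‖gradient f x‖ ^ 2) := by
    have := norm_ne_zero_iff.2 hG
    field_simp
  rw [longKGD, denominator, div_div_eq_mul_div, displacement]

theorem abs_curvature_sub_inner_le (hs : Convex ℝ s) (hf : ∀ z ∈ s, DifferentiableAt ℝ f z)
    (hA : ApproximatesLinearOn (gradient f) A s c) (hx : x ∈ s) (hys : y ∈ s)
    (hy : y = x - α • gradient f x) :
    |2 * (α * ‖gradient f x‖ ^ 2 + (f y - f x)) - ⟪y - x, A (y - x)⟫_ℝ| ≤ c * ‖y - x‖ ^ 2 := by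
  have slope : ⟪gradient f x, y - x⟫_ℝ = -(α * ‖gradient f x‖ ^ 2) := by
    rw [hy, sub_sub_cancel_left, inner_neg_right, inner_smul_right, real_inner_self_eq_norm_sq]
  have remainder := abs_taylor_remainder_le hs hf hA hx hys
  rw [slope, abs_le] at remainder
  rw [abs_le]
  constructor <;> linarith

theorem isNearBarzilaiBorwein_kgdStep (hs : Convex ℝ s) (hf : ∀ z ∈ s, DifferentiableAt ℝ f z)
    (hA : ApproximatesLinearOn (gradient f) A s c) (hμ : 0 < μ)
    (hpos : ∀ v, μ * ‖v‖ ^ 2 ≤ ⟪v, A v⟫_ℝ) (hc : c ≤ μ / 16) (kind : KGDKind) (hα : 0 < α)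
    (hG : gradient f x ≠ 0) (hx : x ∈ s) (hys : y ∈ s) (hy : y = x - α • gradient f x) :
    IsNearBarzilaiBorwein A (y - x) (kgdStep f kind y x α) := by
  have hd : 0 < ‖y - x‖ := by
    rw [hy, sub_sub_cancel_left, norm_neg, norm_smul]
    exact mul_pos (norm_pos_iff.2 hα.ne') (norm_pos_iff.2 hG)
  have hinner : 0 < ⟪y - x, A (y - x)⟫_ℝ := (hpos _).trans_lt' (by positivity)
  have curvature : |2 * (α * ‖gradient f x‖ ^ 2 + (f y - f x)) - ⟪y - x, A (y - x)⟫_ℝ|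
      ≤ ⟪y - x, A (y - x)⟫_ℝ / 16 :=
    calc _ ≤ c * ‖y - x‖ ^ 2 := abs_curvature_sub_inner_le hs hf hA hx hys hy
      _ ≤ μ / 16 * ‖y - x‖ ^ 2 := by gcongr
      _ ≤ ⟪y - x, A (y - x)⟫_ℝ / 16 := by linarith [hpos (y - x)]
  cases kind with
  | long =>
    rw [kgdStep, longKGD_eq_norm_sq_div hα hG hy]
    exact isNearBarzilaiBorwein_long hinner curvature
  | short =>
    refine isNearBarzilaiBorwein_short hinner curvature ?_
    have norm_ge : μ * ‖y - x‖ ≤ ‖A (y - x)‖ := by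
      refine le_of_mul_le_mul_left ?_ hd
      linarith [hpos (y - x), real_inner_le_norm (y - x) (A (y - x))]
    calc |‖gradient f y - gradient f x‖ - ‖A (y - x)‖|
        ≤ ‖gradient f y - gradient f x - A (y - x)‖ := abs_norm_sub_norm_le _ _
      _ ≤ c * ‖y - x‖ := hA y hys x hx
      _ ≤ μ / 16 * ‖y - x‖ := by gcongr
      _ ≤ ‖A (y - x)‖ / 16 := by linarith

theorem IsKGDIteration.isPropertyADescent {ι : Type*} [Fintype ι] {kind : KGDKind}
    {x : ℕ → EuclideanSpace ℝ (Fin n)} {α : ℕ → ℝ}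
    {b : OrthonormalBasis ι ℝ (EuclideanSpace ℝ (Fin n))} {lam : ι → ℝ} {L R : ℝ}
    (h : IsKGDIteration f kind x α) (hf : ∀ z ∈ Metric.ball xstar R, DifferentiableAt ℝ f z)
    (hA : ApproximatesLinearOn (gradient f) A (Metric.ball xstar R) c)
    (hcrit : gradient f xstar = 0) (hdiag : DiagonalizedBy A b lam μ L) (hμ : 0 < μ) (hμL : μ ≤ L)
    (hc : c ≤ μ / 16) :
    IsPropertyADescent A b lam (1 / (2 * L)) (2 / μ) R c (fun v => gradient f (xstar + v))
      (fun k => x k - xstar) α where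
  norm_sub_le v hv := by
    have ha : xstar ∈ Metric.ball xstar R := Metric.mem_ball_self ((norm_nonneg v).trans_lt hv)
    simpa [hcrit] using hA (xstar + v) (by simpa using hv) xstar ha
  init_pos := h.init_pos
  iterate k := by
    rw [add_sub_cancel, h.iterate]
    abel
  stepsize k hk hk' hα hG := by
    rw [add_sub_cancel] at hG
    have displacement_ne : x (k + 1) - x k ≠ 0 := by
      rw [h.iterate, sub_sub_cancel_left]
      exact neg_ne_zero.2 (smul_ne_zero hα.ne' hG)
    rw [sub_sub_sub_cancel_right, h.stepsize k hG]
    exact hdiag.hasPropertyA_of_isNearBarzilaiBorwein hμ hμL displacement_ne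
      (isNearBarzilaiBorwein_kgdStep (convex_ball xstar R) hf hA hμ hdiag.mul_norm_sq_le_inner hc
        kind hα hG (mem_ball_iff_norm.2 hk) (mem_ball_iff_norm.2 hk') (h.iterate k))

theorem convergesRLinearly_of_norm_sub_le {x : ℕ → EuclideanSpace ℝ (Fin n)} {C θ : ℝ}
    (hθ0 : 0 < θ) (hθ1 : θ < 1) (hx : ∀ k, ‖x k - xstar‖ ≤ C * θ ^ k) :
    ConvergesRLinearly x xstar := by
  refine ⟨?_, C, θ, hθ0, hθ1, hx⟩
  rw [tendsto_iff_norm_sub_tendsto_zero]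
  refine squeeze_zero (fun _ => norm_nonneg _) hx ?_
  simpa using (tendsto_pow_atTop_nhds_zero_of_lt_one hθ0.le hθ1).const_mul C

theorem mainTheorem3_general (hf : ContDiffAt ℝ 2 f xstar) (hcrit : gradient f xstar = 0)
    (hμ : 0 < μ) (hpos : ∀ v, μ * ‖v‖ ^ 2 ≤ ⟪v, hessian f xstar v⟫_ℝ) :
    ∃ r > 0, ∀ (kind : KGDKind) (x : ℕ → EuclideanSpace ℝ (Fin n)) (α : ℕ → ℝ),
      IsKGDIteration f kind x α → x 0 ∈ Metric.ball xstar r → x 1 ∈ Metric.ball xstar r →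
        ConvergesRLinearly x xstar := by
  obtain ⟨b, lam, L, hμL, hdiag⟩ :=
    exists_diagonalizedBy_of_isSymmetric (isSymmetric_fderiv_gradient hf) hpos
  have hL : 0 < L := hμ.trans_le hμL
  have smallest_step : 1 / (2 * L) * μ ≤ 1 / 2 := by
    rw [div_mul_eq_mul_div, div_le_div_iff₀ (by positivity) two_pos]
    linarith
  obtain ⟨θ, C, ε, hθ0, hθ1, hC, hε, rate⟩ :=
    hdiag.exists_linear_rate (β := 2 / μ) hμ (by positivity) (by positivity) smallest_step
  obtain ⟨c, hc0, hc⟩ : ∃ c : ℝ≥0, 0 < c ∧ (c : ℝ) ≤ min ε (μ / 16) :=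
    ⟨⟨min ε (μ / 16), by positivity⟩, lt_min hε (by positivity), le_rfl⟩
  obtain ⟨hcε, hcμ⟩ := le_min_iff.1 hc
  obtain ⟨R, hR, hdiff, approx⟩ := exists_ball_approximatesLinearOn_gradient hf hc0
  have radius_lt : C * (R / (2 * C)) < R := by
    field_simp
    linarith
  refine ⟨R / (2 * C), by positivity, fun kind x α h hx0 hx1 => ?_⟩
  have descent := h.isPropertyADescent hdiff approx hcrit hdiag hμ hμL hcμ
  exact convergesRLinearly_of_norm_sub_le hθ0 hθ1 (rate R (R / (2 * C)) _ _ α (descent.mono hcε)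
    radius_lt (mem_ball_iff_norm.1 hx0).le (mem_ball_iff_norm.1 hx1).le)

end KGD

theorem mainTheorem3 {n : ℕ} (f : EuclideanSpace ℝ (Fin n) → ℝ) (hf : ContDiff ℝ 3 f)
    (xstar : EuclideanSpace ℝ (Fin n)) (hmin : IsLocalMin f xstar)
    (ρ Λ₂ : ℝ) (hρ : 0 < ρ) (hΛ₂ : 0 < Λ₂)
    (hconv : ∀ x ∈ Metric.ball xstar ρ, ∀ v : EuclideanSpace ℝ (Fin n),
      Λ₂ * ‖v‖ ^ 2 ≤ inner ℝ v (hessian f x v)) :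
    ∃ r : ℝ, 0 < r ∧ r < ρ ∧
      ∀ δ : ℝ, 0 < δ → δ < r →
        ∀ (kind : KGDKind) (x : ℕ → EuclideanSpace ℝ (Fin n)) (α : ℕ → ℝ),
          IsKGDIteration f kind x α →
          IsCompact {y : EuclideanSpace ℝ (Fin n) | f y ≤ f (x 0)} →
          x 0 ∈ Metric.ball xstar δ → x 1 ∈ Metric.ball xstar δ →
          ConvergesRLinearly x xstar := by
  have hcrit : gradient f xstar = 0 := by simp [gradient, hmin.fderiv_eq_zero]
  obtain ⟨r, hr, converges⟩ := mainTheorem3_general (hf.of_le (by norm_num)).contDiffAt hcrit hΛ₂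
    (hconv xstar (Metric.mem_ball_self hρ))
  refine ⟨min r (ρ / 2), lt_min hr (half_pos hρ), (min_le_right _ _).trans_lt (half_lt_self hρ),
    fun δ _ hδ kind x α h _ hx0 hx1 => ?_⟩
  have ball_subset := Metric.ball_subset_ball (x := xstar) (hδ.le.trans (min_le_left r (ρ / 2)))
  exact converges kind x α h (ball_subset hx0) (ball_subset hx1)
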